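/- Let $S$ be a topological semilattice, that is, a partially ordered set in which any two elements $x,y$ have a supremum $x\oplus y$, endowed with a Hausdorff topology for which $(x,y)\mapsto x\oplus y$ is jointly continuous. A subset of $S$ is called convex if it is closed under $\oplus$ (the empty set is convex), and the convex hull $\operatorname{co}(A)$ of $A\subset S$ is the smallest convex set containing $A$. Assume that $S$ is locally convex: every point of $S$ has a basis of convex neighbourhoods. The weak topology on $S$ is the topology generated by the sets $\psi^{-1}(V)$, where $V$ is open in $[0,1]$ and $\psi:S\to[0,1]$ is continuous with $\psi(x\oplus y)=\max(\psi(x),\psi(y))$ for all $x,y\in S$. A line is a chain in $S$ that has an upper bound in $S$ and is not relatively compact, i.e. its closure in $S$ is not compact. An extreme point of $K\subset S$ is an element $x\in K$ with $x\notin\operatorname{co}(K\setminus\{x\})$; the set of extreme points of $K$ is denoted by $\operatorname{ex}K$. Theorem (Klee–Krein–Milman for semilattices). Let $K$ be a convex subset of $S$ that is locally compact (in the topology induced by that of $S$) and closed in the weak topology, and suppose that no subset of $K$ is a line. Then $K$ is the weakly-closed convex hull of its extreme points, i.e. $K$ is the closure of $\operatorname{co}(\operatorname{ex}K)$ in the weak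 topology. Moreover, the extreme points of $K$ are exactly its coirreducible elements, i.e. the elements $x\in K$ such that, for every nonempty finite subset $F$ of $K$ with supremum $x$, one has $x\in F$. -/

import Mathlib

open Topology

namespace TopSemilattice

/-- The convex hull of `A` in the algebraic convexity of a (join-)semilattice, whose convex sets are
the subsemilattices (`SupClosed` sets, the empty set included): the subsemilattice generated
by `A`, i.e. the least subsemilattice containing `A`. -/
def convHull {S : Type*} [SemilatticeSup S] (A : Set S) : Set S :=
  supClosure A

/-- `x` is an extreme point of `A`: `x ∈ A` and `x` is not in the convex hull of `A \ {x}`. -/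
def extremePts {S : Type*} [SemilatticeSup S] (A : Set S) : Set S :=
  {x | x ∈ A ∧ x ∉ convHull (A \ {x})}

/-- `x` is coirreducible in `K`: `x ∈ K`, and whenever `x` is the join of a nonempty finite
subset `F` of `K`, then `x ∈ F`. -/
def IsCoirreducible {S : Type*} [SemilatticeSup S] (K : Set S) (x : S) : Prop :=
  x ∈ K ∧ ∀ (F : Finset S) (hF : F.Nonempty), (F : Set S) ⊆ K → x = F.sup' hF id → x ∈ F

/-- Local convexity: every point has a basis of neighbourhoods that are subsemilattices. -/
def LocallyConvex (S : Type*) [SemilatticeSup S] [TopologicalSpace S] : Prop :=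
  ∀ x : S, (𝓝 x).HasBasis (fun U : Set S => U ∈ 𝓝 x ∧ SupClosed U) id

/-- A line: an upper-bounded chain that is not relatively compact. -/
def IsLine {S : Type*} [SemilatticeSup S] [TopologicalSpace S] (C : Set S) : Prop :=
  IsChain (· ≤ ·) C ∧ BddAbove C ∧ ¬ IsCompact (closure C)

/-- The weak topology: the topology generated by the sets `ψ ⁻¹(V)`, for `V` open in `[0, 1]` and
`ψ : S → [0, 1]` a continuous map with `ψ (x ⊔ y) = max (ψ x) (ψ y)`. -/
@[reducible] def weakTopology (S : Type*) [SemilatticeSup S] [TopologicalSpace S] : TopologicalSpace S :=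
  TopologicalSpace.generateFrom
    {U : Set S | ∃ ψ : SupHom S (Set.Icc (0 : ℝ) 1), Continuous ψ ∧
      ∃ V : Set (Set.Icc (0 : ℝ) 1), IsOpen V ∧ U = ψ ⁻¹' V}

/-- `K` is closed in the weak topology. -/
def WeaklyClosed {S : Type*} [SemilatticeSup S] [TopologicalSpace S] (K : Set S) : Prop :=
  IsClosed[weakTopology S] K

/-- The weakly-closed convex hull: the closure, in the weak topology, of the convex hull. -/
def weaklyClosedConvHull {S : Type*} [SemilatticeSup S] [TopologicalSpace S] (A : Set S) : Set S :=
  @closure S (weakTopology S) (convHull A)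

end TopSemilattice

namespace TopSemilattice

/-! A basic weak neighbourhood of `x ∈ K` involves finitely many maps `ψ`. For each, the closed set
of `y ∈ K` with `ψ x ≤ ψ y` has a minimal element `p ≤ x`: without lines, bounded chains are
relatively compact, so Zorn applies downwards. As `ψ` turns joins into maxima, `p` is coirreducible,
and monotonicity gives `ψ p = ψ x`. The join of these `p` lies in the hull and, squeezed below `x`,
agrees with `x` under every `ψ`. -/

variable {S : Type*} [SemilatticeSup S]

/-- The extreme points of any set are exactly its coirreducible elements. -/
theorem extremePts_eq_setOf_isCoirreducible (K : Set S) :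
    extremePts K = {x | IsCoirreducible K x} := by
  ext x
  refine and_congr_right fun _ ↦ ⟨fun h F hF hFK hx ↦ ?_, ?_⟩
  · by_contra hxF
    exact h ⟨F, hF, fun y hy ↦ ⟨hFK hy, fun hyx ↦ hxF (hyx ▸ hy)⟩, hx.symm⟩
  · rintro h ⟨F, hF, hFK, hx⟩
    exact (hFK (h F hF (fun y hy ↦ (hFK hy).1) hx.symm)).2 rfl

/-- An element that is minimal among the elements of `K` where a supremum-preserving map to a
chain is at least `c` is coirreducible. -/
theorem isCoirreducible_of_minimal {L : Type*} [LinearOrder L] {K : Set S} (ψ : SupHom S L)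
    {c : L} {p : S} (hp : Minimal (fun y ↦ y ∈ K ∧ c ≤ ψ y) p) : IsCoirreducible K p := by
  refine ⟨hp.prop.1, fun F hF hFK hpF ↦ ?_⟩
  have hc : c ≤ F.sup' hF ψ := by
    have := hp.prop.2
    rwa [hpF, map_finset_sup' ψ hF id] at this
  obtain ⟨y, hyF, hy⟩ := (Finset.le_sup'_iff hF).1 hc
  have hyp : y ≤ p := hpF ▸ Finset.le_sup' id hyF
  exact hp.eq_of_le ⟨hFK hyF, hy⟩ hyp ▸ hyF

variable [TopologicalSpace S]

theorem le_weakTopology : ‹TopologicalSpace S› ≤ weakTopology S := by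
  refine le_generateFrom ?_
  rintro _ ⟨ψ, hψ, V, hV, rfl⟩
  exact hV.preimage hψ

theorem WeaklyClosed.isClosed {K : Set S} (hK : WeaklyClosed K) : IsClosed K :=
  IsClosed.mono hK le_weakTopology

variable [T2Space S] [ContinuousSup S]

theorem isClosed_Iic (a : S) : IsClosed (Set.Iic a) := by
  have : Set.Iic a = {y | y ⊔ a = a} := by
    ext y
    simp
  rw [this]
  exact isClosed_eq (by fun_prop) continuous_const

/-- A nonempty relatively compact chain has a lower bound in its closure. -/
theorem exists_mem_closure_lowerBound {C : Set S} (hC : IsChain (· ≤ ·) C) (hne : C.Nonempty)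
    (hcomp : IsCompact (closure C)) : ∃ m ∈ closure C, ∀ c ∈ C, m ≤ c := by
  have : Nonempty C := hne.to_subtype
  have hdir : Directed (· ⊇ ·) fun c : C ↦ closure C ∩ Set.Iic (c : S) := by
    intro a b
    rcases hC.total a.2 b.2 with h | h
    · exact ⟨a, subset_rfl, Set.inter_subset_inter_right _ (Set.Iic_subset_Iic.2 h)⟩
    · exact ⟨b, Set.inter_subset_inter_right _ (Set.Iic_subset_Iic.2 h), subset_rfl⟩
  obtain ⟨m, hm⟩ := IsCompact.nonempty_iInter_of_directed_nonempty_isCompact_isClosed _ hdir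
    (fun c ↦ ⟨c, subset_closure c.2, le_rfl⟩)
    (fun c ↦ hcomp.inter_right (isClosed_Iic _))
    (fun c ↦ isClosed_closure.inter (isClosed_Iic _))
  rw [Set.mem_iInter] at hm
  exact ⟨m, (hm (Classical.arbitrary C)).1, fun c hc ↦ (hm ⟨c, hc⟩).2⟩

/-- In a closed set without lines, every element of a closed subset dominates a minimal one. -/
theorem exists_le_minimal {K A : Set S} (hK : ∀ C : Set S, C ⊆ K → ¬ IsLine C)
    (hA : IsClosed A) (hAK : A ⊆ K) {x : S} (hx : x ∈ A) :
    ∃ p ≤ x, Minimal (· ∈ A) p := by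
  -- Zorn in the dual order. Cutting down to `Set.Iic x` bounds the chains above, as the definition
  -- of a line requires, and loses no minimality, since anything below `p` is below `x`.
  refine zorn_le_nonempty₀ (α := Sᵒᵈ) (A ∩ Set.Iic (α := S) x) (fun C hCA hC y hy ↦ ?_) x ⟨hx, le_rfl⟩
    |>.elim fun (p : S) ⟨(hpx : p ≤ x), hp⟩ ↦ ⟨p, hpx, hp.prop.1, fun y hy (hyp : y ≤ p) ↦
      hp.le_of_ge ⟨hy, hyp.trans hpx⟩ hyp⟩
  have hcomp : IsCompact (closure (C : Set S)) := by
    by_contra h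
    exact hK C (fun c hc ↦ hAK (hCA hc).1) ⟨hC.symm, ⟨x, fun c hc ↦ (hCA hc).2⟩, h⟩
  obtain ⟨m, hm, hmC⟩ := exists_mem_closure_lowerBound (S := S) hC.symm ⟨y, hy⟩ hcomp
  exact ⟨m, closure_minimal hCA (hA.inter (isClosed_Iic x)) hm, hmC⟩

/-- In a closed set without lines, a continuous supremum-preserving map to a chain takes each of
its values at `x` on a coirreducible element below `x`. -/
theorem exists_isCoirreducible_le_map_eq {L : Type*} [LinearOrder L] [TopologicalSpace L]
    [OrderClosedTopology L] {K : Set S} (hKcl : IsClosed K)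
    (hK : ∀ C : Set S, C ⊆ K → ¬ IsLine C) (ψ : SupHom S L) (hψ : Continuous ψ)
    {x : S} (hx : x ∈ K) : ∃ p ≤ x, IsCoirreducible K p ∧ ψ p = ψ x := by
  obtain ⟨p, hpx, hp⟩ := exists_le_minimal (A := K ∩ ψ ⁻¹' Set.Ici (ψ x)) hK
    (hKcl.inter (isClosed_Ici.preimage hψ)) Set.inter_subset_left ⟨hx, le_rfl⟩
  exact ⟨p, hpx, isCoirreducible_of_minimal ψ hp, (OrderHomClass.mono ψ hpx).antisymm hp.prop.2⟩

theorem subset_weaklyClosedConvHull_extremePts {K : Set S} (hKcl : IsClosed K)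
    (hK : ∀ C : Set S, C ⊆ K → ¬ IsLine C) : K ⊆ weaklyClosedConvHull (extremePts K) := by
  intro x hx
  have hbasis := @TopologicalSpace.isTopologicalBasis_of_subbasis S (weakTopology S) _ rfl
  refine (@TopologicalSpace.IsTopologicalBasis.mem_closure_iff S (weakTopology S) _ hbasis _ _).2 ?_
  rintro _ ⟨f, ⟨hf, hfg⟩, rfl⟩ hxf
  -- Asking for the whole interval from `y` to `x` lets the induction enlarge `y` by further joins.
  suffices ∃ y ∈ convHull (extremePts K), y ≤ x ∧ ∀ s ∈ f, ∀ z, y ≤ z → z ≤ x → z ∈ s by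
    obtain ⟨y, hy, hyx, hyf⟩ := this
    exact ⟨y, fun s hs ↦ hyf s hs y le_rfl hyx, hy⟩
  have key (ψ : SupHom S (Set.Icc (0 : ℝ) 1)) (hψ : Continuous ψ) :
      ∃ p ∈ convHull (extremePts K), p ≤ x ∧ ψ p = ψ x := by
    obtain ⟨p, hpx, hp, hpψ⟩ := exists_isCoirreducible_le_map_eq hKcl hK ψ hψ hx
    refine ⟨p, subset_supClosure ?_, hpx, hpψ⟩
    rwa [extremePts_eq_setOf_isCoirreducible]
  induction f, hf using Set.Finite.induction_on with
  | empty =>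
    -- With no constraint left, a constant map still supplies an extreme point below `x`.
    obtain ⟨p, hp, hpx, -⟩ := key (SupHom.const S 0) continuous_const
    exact ⟨p, hp, hpx, by simp⟩
  | @insert s f _ _ ih =>
    rw [Set.insert_subset_iff] at hfg
    replace hxf : x ∈ s ∩ ⋂₀ f := Set.sInter_insert s f ▸ hxf
    obtain ⟨y, hy, hyx, hyf⟩ := ih hfg.2 hxf.2
    obtain ⟨ψ, hψ, V, -, rfl⟩ := hfg.1
    obtain ⟨p, hp, hpx, hpψ⟩ := key ψ hψ
    refine ⟨y ⊔ p, supClosed_supClosure hy hp, sup_le hyx hpx, ?_⟩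
    rintro t (rfl | ht) z hz hzx
    · have hzψ : ψ z = ψ x := (OrderHomClass.mono ψ hzx).antisymm
        (hpψ ▸ OrderHomClass.mono ψ (le_sup_right.trans hz))
      change ψ z ∈ V
      exact hzψ ▸ hxf.1
    · exact hyf t ht z (le_sup_left.trans hz) hzx

end TopSemilattice

theorem mainTheorem1 {S : Type*} [SemilatticeSup S] [TopologicalSpace S] [T2Space S]
    [ContinuousSup S] (hS : TopSemilattice.LocallyConvex S)
    (K : Set S) (hKlc : LocallyCompactSpace K) (hKcl : TopSemilattice.WeaklyClosed K)
    (hKconv : SupClosed K) (hKline : ∀ C : Set S, C ⊆ K → ¬ TopSemilattice.IsLine C) :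
    TopSemilattice.weaklyClosedConvHull (TopSemilattice.extremePts K) = K ∧
      TopSemilattice.extremePts K = {x | TopSemilattice.IsCoirreducible K x} := by
  refine ⟨Set.Subset.antisymm ?_ ?_, TopSemilattice.extremePts_eq_setOf_isCoirreducible K⟩
  · exact @closure_minimal S (TopSemilattice.weakTopology S) _ _
      (supClosure_min (fun x hx ↦ hx.1) hKconv) hKcl
  · exact TopSemilattice.subset_weaklyClosedConvHull_extremePts hKcl.isClosed hKline
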